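/- **Setting.** Let $d\in\{1,2,3\}$ and let $\Omega\subset\mathbb{R}^d$ be a bounded Lipschitz domain with $\partial\Omega=\overline{\Gamma_D\cup\Gamma_N\cup\Gamma_R}$, where $\Gamma_D,\Gamma_N,\Gamma_R$ are pairwise disjoint and $\Gamma_R$ has positive surface measure. Let $\kappa>0$, let $V:=\{v\in W^{1,2}(\Omega;\mathbb{C}) : v=0\text{ on }\Gamma_D\}$ (in the sense of traces) with $\|v\|_V:=(\kappa^2\|v\|_{L^2(\Omega)}^2+\|\nabla v\|_{L^2(\Omega)}^2)^{1/2}$, and for $u,v\in V$ let $$a(u,v):=\int_\Omega\nabla u\cdot\overline{\nabla v}\,dx-\kappa^2\int_\Omega u\overline v\,dx-i\kappa\int_{\Gamma_R}u\overline v\,ds .$$ Let $C_a$ be a constant with $|a(u,v)|\le C_a\|u\|_V\|v\|_V$ for all $u,v\in V$. Let $\mathcal{T}_H$ be a regular (face-to-face) simplicial mesh of $\Omega$ with local mesh widths $H_T:=\operatorname{diam}T$ and mesh size $H:=\max_{T\in\mathcal{T}_H}H_T$. For $T\in\mathcal{T}_H$ let $\Omega_{T,1}:=\bigcup\{T'\in\mathcal{T}_H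 : T'\cap T\ne\emptyset\}$, and let $C_{\mathrm{ol}}:=\max_{T\in\mathcal T_H}\#\{K\in\mathcal{T}_H : K\subset\Omega_{T,1}\}$. Let $\mathcal{N}_H$ be the set of the vertices of $\mathcal T_H$ that do not lie in $\overline{\Gamma_D}$, let $\phi_z$ be the continuous piecewise affine nodal basis function of the vertex $z$, and let $$\mathcal{I}_Hv:=\sum_{z\in\mathcal{N}_H}\frac{\int_\Omega v\,\phi_z\,dx}{\int_\Omega\phi_z\,dx}\,\phi_z,\qquad W:=\{v\in V : \mathcal{I}_Hv=0\}.$$ Let $C_I>0$ be a constant with $$H_T^{-1}\|v-\mathcal{I}_Hv\|_{L^2(T)}+\|\nabla(v-\mathcal{I}_Hv)\|_{L^2(T)}\le C_I\|\nabla v\|_{L^2(\Omega_{T,1})}\quad\text{for all }v\in V,\ T\in\mathcal{T}_H .$$ **Lemma (well-posedness of the correction operator).** Assume the resolution condition $H\kappa\le\dfrac{1}{\sqrt{2C_{\mathrm{ol}}}\,C_I}$. Then: 1. $\|\nabla w\|_{L^2(\Omega)}\le\|w\|_V\le\sqrt{3/2}\,\|\nabla w\|_{L^2(\Omega)}$ for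 all $w\in W$, so that $\|\nabla\cdot\|_{L^2(\Omega)}$ and $\|\cdot\|_V$ are equivalent norms on $W$. 2. $\operatorname{Re}a(w,w)\ge\frac13\|w\|_V^2$ for all $w\in W$. 3. For every $v\in V$ there is exactly one $\mathcal{C}_\infty v\in W$ with $a(\mathcal{C}_\infty v,w)=a(v,w)$ for all $w\in W$, and exactly one $\mathcal{C}^*_\infty v\in W$ with $a(w,\mathcal{C}^*_\infty v)=a(w,v)$ for all $w\in W$. The maps $\mathcal{C}_\infty,\mathcal{C}_\infty^*:V\to W$ are linear, and $$\|\mathcal{C}_\infty v\|_V\le 3C_a\|v\|_V,\qquad \|\mathcal{C}^*_\infty v\|_V\le 3C_a\|v\|_V\qquad\text{for all }v\in V .$$ Moreover, for every $v\in V$ one has $\overline v\in V$, $\mathcal{C}_\infty^*v=\overline{\mathcal{C}_\infty\overline v}$ and $\|\mathcal{C}_\infty^*v\|_V=\|\mathcal{C}_\infty\overline v\|_V$ (hence $\|\mathcal{C}_\infty^*v\|_V=\|\mathcal{C}_\infty v\|_V$ for real-valued $v$). -/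

import Mathlib

open MeasureTheory Set
open scoped ContDiff ComplexConjugate NNReal ENNReal

noncomputable section

namespace Helmholtz

/-- Euclidean space `ℝ^d`. -/
abbrev Rd (d : ℕ) : Type := EuclideanSpace ℝ (Fin d)

/-- The space `ℂ^d` with its Hermitian inner product (values of gradients). -/
abbrev Cd (d : ℕ) : Type := EuclideanSpace ℂ (Fin d)

variable {d : ℕ}

/-! ### Domain and boundary -/

/-- A bounded Lipschitz domain: a bounded connected (nonempty) open set which, near each of its
boundary points and after a rotation (`e` is the vertical direction, `y - ⟪e, y⟫ e` the horizontal
part of `y`), is the set of points above the graph of a Lipschitz function. -/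
structure IsLipschitzDomain (Ω : Set (Rd d)) : Prop where
  isOpen : IsOpen Ω
  isConnected : IsConnected Ω
  isBounded : Bornology.IsBounded Ω
  lipschitz_boundary : ∀ x ∈ frontier Ω, ∃ (e : Rd d) (r : ℝ) (K : ℝ≥0) (g : Rd d → ℝ),
    ‖e‖ = 1 ∧ 0 < r ∧ LipschitzWith K g ∧
      ∀ y ∈ Metric.ball x r, y ∈ Ω ↔ g (y - inner ℝ e y • e) < inner ℝ e y

/-- The surface measure: the `(d-1)`-dimensional Hausdorff measure, normalised so that it is the
usual area on hyperplanes. -/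
def surface (d : ℕ) : Measure (Rd d) := Measure.euclideanHausdorffMeasure (d - 1)

/-- The boundary of `Ω` is split into a Dirichlet, a Neumann and a Robin part; the Robin part has
positive surface measure. -/
structure IsBoundaryPartition (Ω ΓD ΓN ΓR : Set (Rd d)) : Prop where
  measurableSet_dirichlet : MeasurableSet ΓD
  measurableSet_neumann : MeasurableSet ΓN
  measurableSet_robin : MeasurableSet ΓR
  disjoint_dirichlet_neumann : Disjoint ΓD ΓN
  disjoint_dirichlet_robin : Disjoint ΓD ΓR
  disjoint_neumann_robin : Disjoint ΓN ΓR
  frontier_eq : frontier Ω = closure (ΓD ∪ ΓN ∪ ΓR)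
  robin_pos : 0 < surface d ΓR

/-! ### The Sobolev space -/

/-- The complex scalar-valued space `L²(Ω)`. -/
abbrev L2 (Ω : Set (Rd d)) : Type := Lp ℂ 2 ((volume : Measure (Rd d)).restrict Ω)

/-- The space `L²(Ω)^d` of complex vector fields. -/
abbrev L2vec (Ω : Set (Rd d)) : Type := Lp (Cd d) 2 ((volume : Measure (Rd d)).restrict Ω)

/-- The space `L²(S)` on a part `S` of the boundary. -/
abbrev L2bdry (S : Set (Rd d)) : Type := Lp ℂ 2 ((surface d).restrict S)

/-- The classical partial derivative `∂ᵢφ (x)`. -/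
def pderiv {F : Type} [NormedAddCommGroup F] [NormedSpace ℝ F] (i : Fin d) (φ : Rd d → F)
    (x : Rd d) : F :=
  fderiv ℝ φ x (EuclideanSpace.single i 1)

/-- The classical gradient of a complex-valued function. -/
def cgrad (φ : Rd d → ℂ) (x : Rd d) : Cd d := WithLp.toLp 2 fun i => pderiv i φ x

/-- `G` is the weak gradient of `u` on `Ω`. -/
def IsWeakGradient (Ω : Set (Rd d)) (u : L2 Ω) (G : L2vec Ω) : Prop :=
  ∀ φ : Rd d → ℝ, ContDiff ℝ ∞ φ → HasCompactSupport φ → tsupport φ ⊆ Ω → ∀ i : Fin d,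
    ∫ x in Ω, pderiv i φ x • u x = -∫ x in Ω, φ x • (G x) i

/-- Smooth functions on `ℝ^d`, recorded through their restriction to `Ω`, the restriction of the
gradient to `Ω`, and the restriction to the part `S` of the boundary. -/
def smoothGraph (Ω S : Set (Rd d)) : Submodule ℂ (L2 Ω × L2vec Ω × L2bdry S) where
  carrier := {p | ∃ φ : Rd d → ℂ, ContDiff ℝ ∞ φ ∧
    p.1 =ᵐ[volume.restrict Ω] φ ∧ p.2.1 =ᵐ[volume.restrict Ω] cgrad φ ∧
    p.2.2 =ᵐ[(surface d).restrict S] φ}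
  zero_mem' := by
    refine ⟨fun _ => 0, contDiff_const, Lp.coeFn_zero _ _ _, ?_, Lp.coeFn_zero _ _ _⟩
    filter_upwards [Lp.coeFn_zero (Cd d) 2 ((volume : Measure (Rd d)).restrict Ω)] with x hx
    rw [Prod.snd_zero, Prod.fst_zero, hx]
    ext i
    simp [cgrad, pderiv]
  add_mem' := by
    rintro p q ⟨φ, hφ, h1, h2, h3⟩ ⟨ψ, hψ, k1, k2, k3⟩
    refine ⟨φ + ψ, hφ.add hψ, (Lp.coeFn_add _ _).trans (h1.add k1), ?_,
      (Lp.coeFn_add _ _).trans (h3.add k3)⟩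
    filter_upwards [Lp.coeFn_add p.2.1 q.2.1, h2, k2] with x hx e2 f2
    rw [Prod.snd_add, Prod.fst_add, hx, Pi.add_apply, e2, f2]
    ext i
    simp [cgrad, pderiv, fderiv_add (hφ.differentiable (by simp) x)
      (hψ.differentiable (by simp) x)]
  smul_mem' := by
    rintro c p ⟨φ, hφ, h1, h2, h3⟩
    refine ⟨c • φ, hφ.const_smul c, (Lp.coeFn_smul _ _).trans (h1.const_smul c), ?_,
      (Lp.coeFn_smul _ _).trans (h3.const_smul c)⟩
    filter_upwards [Lp.coeFn_smul c p.2.1, h2] with x hx e2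
    rw [Prod.smul_snd, Prod.smul_fst, hx, Pi.smul_apply, e2]
    ext i
    simp [cgrad, pderiv, fderiv_const_smul (hφ.differentiable (by simp) x) c]

/-- The graph of `u ↦ (∇u, u|_S)` on `W^{1,2}(Ω)`, where `u|_S ∈ L²(S)` is the trace: the triples
`(u, G, g)` for which some smooth functions `φₙ` satisfy `φₙ → u` and `∇φₙ → G` in `L²(Ω)` and
`φₙ|_S → g` in `L²(S)`. -/
def traceGraph (Ω S : Set (Rd d)) : Submodule ℂ (L2 Ω × L2vec Ω × L2bdry S) :=
  (smoothGraph Ω S).topologicalClosure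

lemma integrable_smul_L2 {Ω : Set (Rd d)} {ψ : Rd d → ℝ} {f : Rd d → ℂ} (hψ : Continuous ψ)
    (hc : HasCompactSupport ψ) (hf : MemLp f 2 (volume.restrict Ω)) :
    Integrable (fun x => ψ x • f x) (volume.restrict Ω) :=
  memLp_one_iff_integrable.mp
    (hf.smul ((hψ.memLp_of_hasCompactSupport (μ := volume) (p := 2) hc).restrict Ω) (r := 1))

lemma memLp_coord {Ω : Set (Rd d)} (G : L2vec Ω) (i : Fin d) :
    MemLp (fun x => (G x) i) 2 (volume.restrict Ω) :=
  (EuclideanSpace.proj (𝕜 := ℂ) i).comp_memLp G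

lemma continuous_pderiv {φ : Rd d → ℝ} (hφ : ContDiff ℝ ∞ φ) (i : Fin d) :
    Continuous (pderiv i φ) :=
  (hφ.continuous_fderiv (by simp)).clm_apply continuous_const

lemma hasCompactSupport_pderiv {φ : Rd d → ℝ} (hφ : HasCompactSupport φ) (i : Fin d) :
    HasCompactSupport (pderiv i φ) :=
  hφ.fderiv_apply (𝕜 := ℝ) (EuclideanSpace.single i 1)

lemma IsWeakGradient.add {Ω : Set (Rd d)} {u u' : L2 Ω} {G G' : L2vec Ω}
    (h : IsWeakGradient Ω u G) (h' : IsWeakGradient Ω u' G') :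
    IsWeakGradient Ω (u + u') (G + G') := by
  intro φ hφ hc hs i
  have e1 : ∫ x in Ω, pderiv i φ x • (u + u' : L2 Ω) x =
      ∫ x in Ω, (pderiv i φ x • u x + pderiv i φ x • u' x) := by
    refine integral_congr_ae ?_
    filter_upwards [Lp.coeFn_add u u'] with x hx
    rw [hx, Pi.add_apply, smul_add]
  have e2 : ∫ x in Ω, φ x • ((G + G' : L2vec Ω) x) i =
      ∫ x in Ω, (φ x • (G x) i + φ x • (G' x) i) := by
    refine integral_congr_ae ?_
    filter_upwards [Lp.coeFn_add G G'] with x hx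
    rw [hx, Pi.add_apply, PiLp.add_apply, smul_add]
  rw [e1, e2, integral_add, integral_add, h φ hφ hc hs i, h' φ hφ hc hs i, neg_add]
  · exact integrable_smul_L2 hφ.continuous hc (memLp_coord G i)
  · exact integrable_smul_L2 hφ.continuous hc (memLp_coord G' i)
  · exact integrable_smul_L2 (continuous_pderiv hφ i) (hasCompactSupport_pderiv hc i) (Lp.memLp u)
  · exact integrable_smul_L2 (continuous_pderiv hφ i) (hasCompactSupport_pderiv hc i) (Lp.memLp u')

lemma IsWeakGradient.smul {Ω : Set (Rd d)} {u : L2 Ω} {G : L2vec Ω} (c : ℂ)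
    (h : IsWeakGradient Ω u G) : IsWeakGradient Ω (c • u) (c • G) := by
  intro φ hφ hc hs i
  have e1 : ∫ x in Ω, pderiv i φ x • (c • u : L2 Ω) x = ∫ x in Ω, c • (pderiv i φ x • u x) := by
    refine integral_congr_ae ?_
    filter_upwards [Lp.coeFn_smul c u] with x hx
    rw [hx, Pi.smul_apply, smul_comm]
  have e2 : ∫ x in Ω, φ x • ((c • G : L2vec Ω) x) i = ∫ x in Ω, c • (φ x • (G x) i) := by
    refine integral_congr_ae ?_
    filter_upwards [Lp.coeFn_smul c G] with x hx
    rw [hx, Pi.smul_apply, PiLp.smul_apply, smul_comm]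
  rw [e1, e2, integral_smul, integral_smul, h φ hφ hc hs i, smul_neg]

lemma IsWeakGradient.zero (Ω : Set (Rd d)) : IsWeakGradient Ω (0 : L2 Ω) (0 : L2vec Ω) := by
  intro φ hφ hc hs i
  have e1 : ∫ x in Ω, pderiv i φ x • (0 : L2 Ω) x = 0 := by
    rw [← integral_zero (Rd d) ℂ (μ := volume.restrict Ω)]
    refine integral_congr_ae ?_
    filter_upwards [Lp.coeFn_zero ℂ 2 ((volume : Measure (Rd d)).restrict Ω)] with x hx
    rw [hx, Pi.zero_apply, smul_zero]
  have e2 : ∫ x in Ω, φ x • ((0 : L2vec Ω) x) i = 0 := by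
    rw [← integral_zero (Rd d) ℂ (μ := volume.restrict Ω)]
    refine integral_congr_ae ?_
    filter_upwards [Lp.coeFn_zero (Cd d) 2 ((volume : Measure (Rd d)).restrict Ω)] with x hx
    rw [hx, Pi.zero_apply, PiLp.zero_apply, smul_zero]
  rw [e1, e2, neg_zero]

/-- The space `V = {v ∈ W^{1,2}(Ω) | v = 0 on Γ_D}`. A function `v ∈ V` is recorded together with
its weak gradient and its trace on `Γ_D ∪ Γ_R` (the part of the boundary where boundary values
enter the problem); both are determined by `v` when `Ω` is a bounded Lipschitz domain, and every
`v ∈ W^{1,2}(Ω)` has them. -/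
def V (Ω ΓD ΓR : Set (Rd d)) : Submodule ℂ (L2 Ω × L2vec Ω × L2bdry (ΓD ∪ ΓR)) where
  carrier := {p | IsWeakGradient Ω p.1 p.2.1 ∧ p ∈ traceGraph Ω (ΓD ∪ ΓR) ∧
    ∀ᵐ x ∂((surface d).restrict (ΓD ∪ ΓR)), x ∈ ΓD → p.2.2 x = 0}
  zero_mem' := by
    refine ⟨IsWeakGradient.zero Ω, zero_mem _, ?_⟩
    filter_upwards [Lp.coeFn_zero ℂ 2 ((surface d).restrict (ΓD ∪ ΓR))] with x hx _
    rw [Prod.snd_zero, Prod.snd_zero, hx, Pi.zero_apply]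
  add_mem' := by
    rintro p q ⟨h1, h2, h3⟩ ⟨k1, k2, k3⟩
    refine ⟨h1.add k1, add_mem h2 k2, ?_⟩
    filter_upwards [Lp.coeFn_add p.2.2 q.2.2, h3, k3] with x hx e f hD
    rw [Prod.snd_add, Prod.snd_add, hx, Pi.add_apply, e hD, f hD, add_zero]
  smul_mem' := by
    rintro c p ⟨h1, h2, h3⟩
    refine ⟨h1.smul c, Submodule.smul_mem _ c h2, ?_⟩
    filter_upwards [Lp.coeFn_smul c p.2.2, h3] with x hx e hD
    rw [Prod.smul_snd, Prod.smul_snd, hx, Pi.smul_apply, e hD, smul_zero]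

section Form

variable {Ω ΓD ΓR : Set (Rd d)}

/-- The underlying function of `v ∈ V`. -/
def fn (v : V Ω ΓD ΓR) : L2 Ω := v.1.1

/-- The weak gradient of `v ∈ V`. -/
def grad (v : V Ω ΓD ΓR) : L2vec Ω := v.1.2.1

/-- The trace of `v ∈ V` on `Γ_D ∪ Γ_R`. -/
def tr (v : V Ω ΓD ΓR) : L2bdry (ΓD ∪ ΓR) := v.1.2.2

/-- The `κ`-weighted norm `‖v‖_V = (κ² ‖v‖² + ‖∇v‖²)^{1/2}`. -/
def normV (κ : ℝ) (v : V Ω ΓD ΓR) : ℝ := √(κ ^ 2 * ‖fn v‖ ^ 2 + ‖grad v‖ ^ 2)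

/-- The Helmholtz form `a(u, v) = (∇u, ∇v)_Ω - κ² (u, v)_Ω - iκ (u, v)_{Γ_R}`, with inner products
that are conjugate-linear in the second argument `v` of `a`. -/
def form (κ : ℝ) (u v : V Ω ΓD ΓR) : ℂ :=
  (∫ x in Ω, ∑ i, (grad u x) i * conj ((grad v x) i))
    - (κ : ℂ) ^ 2 * (∫ x in Ω, fn u x * conj (fn v x))
    - Complex.I * (κ : ℂ) * (∫ x in ΓR, tr u x * conj (tr v x) ∂(surface d))

/-- `C_a` is a continuity constant of the form `a`. -/
def IsContinuityConstant (Ω ΓD ΓR : Set (Rd d)) (κ Ca : ℝ) : Prop :=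
  ∀ u v : V Ω ΓD ΓR, ‖form κ u v‖ ≤ Ca * normV κ u * normV κ v

/-- `v'` is the complex conjugate of `v`. -/
def IsConj (v v' : V Ω ΓD ΓR) : Prop :=
  (∀ᵐ x ∂((volume : Measure (Rd d)).restrict Ω), fn v' x = conj (fn v x)) ∧
  (∀ᵐ x ∂((volume : Measure (Rd d)).restrict Ω), ∀ i, (grad v' x) i = conj ((grad v x) i)) ∧
  (∀ᵐ x ∂((surface d).restrict (ΓD ∪ ΓR)), tr v' x = conj (tr v x))

end Form

/-! ### Meshes -/

/-- A regular (face-to-face) simplicial mesh of `Ω`. An element is given by the finite set of its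
`d + 1` affinely independent vertices; two elements meet in the (possibly empty) face spanned by
their common vertices; the closed elements cover exactly `closure Ω`. -/
structure Mesh (Ω : Set (Rd d)) where
  elements : Finset (Finset (Rd d))
  card_eq : ∀ s ∈ elements, s.card = d + 1
  indep : ∀ s ∈ elements, AffineIndependent ℝ ((↑) : s → Rd d)
  inter_subset : ∀ s ∈ elements, ∀ t ∈ elements,
    convexHull ℝ (s : Set (Rd d)) ∩ convexHull ℝ (t : Set (Rd d)) ⊆
      convexHull ℝ ((s : Set (Rd d)) ∩ (t : Set (Rd d)))
  cover : ⋃ s ∈ elements, convexHull ℝ (s : Set (Rd d)) = closure Ω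

/-- The closed simplex with vertex set `s`. -/
def simplex (s : Finset (Rd d)) : Set (Rd d) := convexHull ℝ (s : Set (Rd d))

namespace Mesh

variable {Ω : Set (Rd d)} (T : Mesh Ω)

/-- The mesh size `H`, the maximum of the local mesh widths `H_s = diam s`. -/
def size : ℝ := ⨆ s : T.elements, Metric.diam (simplex s.1)

open Classical in
/-- The element patch `Ω_{s,1}`, the union of `s` and its neighbours. -/
def patch (s : Finset (Rd d)) : Set (Rd d) :=
  ⋃ t ∈ {t ∈ T.elements | (simplex t ∩ simplex s).Nonempty}, simplex t

open Classical in
/-- The overlap constant `C_ol`, the maximal number of elements in an element patch. -/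
def overlap : ℕ := T.elements.sup fun s => {t ∈ T.elements | simplex t ⊆ T.patch s}.card

/-- The barycentric coordinate system of an element. -/
def basis (s : T.elements) : AffineBasis s.1 ℝ (Rd d) where
  toFun := (↑)
  ind' := T.indep s.1 s.2
  tot' := by
    rw [(T.indep s.1 s.2).affineSpan_eq_top_iff_card_eq_finrank_add_one]
    simp [T.card_eq s.1 s.2]

open Classical in
/-- The barycentric coordinate of `x` belonging to the vertex `z`, if `x` lies in the element `s`
and `z` is a vertex of `s`; zero otherwise. -/
def localHat (s : T.elements) (z x : Rd d) : ℝ≥0 :=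
  if h : z ∈ s.1 then
    if x ∈ simplex s.1 then ((T.basis s).coord ⟨z, h⟩ x).toNNReal else 0
  else 0

/-- The real-valued nodal basis function (hat function) `φ_z`: continuous and piecewise affine,
equal to `1` at `z` and to `0` at all other vertices. In an element it is the barycentric
coordinate of `z`; all elements containing a point yield the same value there, except that an
element without the vertex `z` contributes `0`. -/
def hat (z x : Rd d) : ℝ := ((T.elements.attach.sup fun s => T.localHat s z x : ℝ≥0) : ℝ)

open Classical in
/-- The set `N_H` of the vertices that do not lie on the Dirichlet boundary. -/
def nodes (ΓD : Set (Rd d)) : Finset (Rd d) :=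
  {z ∈ T.elements.biUnion id | z ∉ closure ΓD}

lemma isCompact_simplex (s : Finset (Rd d)) : IsCompact (simplex s) :=
  s.finite_toSet.isCompact_convexHull ℝ

lemma measurable_localHat (s : T.elements) (z : Rd d) : Measurable (T.localHat s z) := by
  classical
  unfold localHat
  by_cases h : z ∈ s.1
  · simp only [h, dite_true]
    refine Measurable.ite (isCompact_simplex s.1).isClosed.measurableSet ?_ measurable_const
    exact (AffineMap.continuous_of_finiteDimensional
      ((T.basis s).coord ⟨z, h⟩)).measurable.real_toNNReal
  · simp only [h, dite_false]
    exact measurable_const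

lemma measurable_hat (z : Rd d) : Measurable (T.hat z) := by
  unfold hat
  refine Measurable.coe_nnreal_real ?_
  induction T.elements.attach using Finset.cons_induction with
  | empty => simp
  | cons s F hs ih =>
    simp only [Finset.sup_cons]
    exact (T.measurable_localHat s z).sup ih

lemma localHat_le_one (s : T.elements) (z x : Rd d) : T.localHat s z x ≤ 1 := by
  classical
  unfold localHat
  split_ifs with h hx
  · have hr : Set.range (T.basis s) = (s.1 : Set (Rd d)) := Subtype.range_coe
    have hx' : x ∈ convexHull ℝ (Set.range (T.basis s)) := by rw [hr]; exact hx
    rw [AffineBasis.convexHull_eq_nonneg_coord] at hx'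
    rw [Real.toNNReal_le_one, ← (T.basis s).sum_coord_apply_eq_one x]
    exact Finset.single_le_sum (f := fun i => (T.basis s).coord i x) (fun i _ => hx' i)
      (Finset.mem_univ _)
  · exact zero_le_one
  · exact zero_le_one

lemma hat_nonneg (z x : Rd d) : 0 ≤ T.hat z x := NNReal.coe_nonneg _

lemma hat_le_one (z x : Rd d) : T.hat z x ≤ 1 := by
  unfold hat
  exact_mod_cast Finset.sup_le fun s _ => T.localHat_le_one s z x

lemma volume_lt_top {Ω : Set (Rd d)} (T : Mesh Ω) : volume Ω < ⊤ := by
  have h : IsCompact (closure Ω) := by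
    rw [← T.cover]
    exact T.elements.isCompact_biUnion fun s _ => isCompact_simplex s
  exact (measure_mono subset_closure).trans_lt h.measure_lt_top

lemma memLp_hat (z : Rd d) : MemLp (fun x => (T.hat z x : ℂ)) 2 (volume.restrict Ω) := by
  have : IsFiniteMeasure ((volume : Measure (Rd d)).restrict Ω) :=
    ⟨by simpa using T.volume_lt_top⟩
  refine MemLp.of_bound
    (Complex.measurable_ofReal.comp (T.measurable_hat z)).aestronglyMeasurable 1 ?_
  filter_upwards with x
  rw [Complex.norm_real, Real.norm_of_nonneg (T.hat_nonneg z x)]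
  exact T.hat_le_one z x

section Interpolation

variable {ΓD ΓR : Set (Rd d)}

/-- The nodal functional `α_z(v) = (v, φ_z)_Ω / (1, φ_z)_Ω`. -/
def nodal (z : Rd d) (v : V Ω ΓD ΓR) : ℂ :=
  (∫ x in Ω, fn v x * (T.hat z x : ℂ)) / (∫ x in Ω, (T.hat z x : ℂ))

/-- The weighted Clément interpolant `I_H v = ∑_z α_z(v) φ_z`. -/
def interp (v : V Ω ΓD ΓR) (x : Rd d) : ℂ :=
  ∑ z ∈ T.nodes ΓD, T.nodal z v * (T.hat z x : ℂ)

lemma integrable_mul_hat (z : Rd d) (u : L2 Ω) :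
    Integrable (fun x => u x * (T.hat z x : ℂ)) (volume.restrict Ω) :=
  (Lp.memLp u).integrable_mul (T.memLp_hat z)

lemma nodal_add (z : Rd d) (v w : V Ω ΓD ΓR) :
    T.nodal z (v + w) = T.nodal z v + T.nodal z w := by
  unfold nodal
  rw [← add_div, ← integral_add (T.integrable_mul_hat z (fn v)) (T.integrable_mul_hat z (fn w))]
  congr 1
  refine integral_congr_ae ?_
  filter_upwards [Lp.coeFn_add (fn v) (fn w)] with x hx
  rw [← add_mul, ← Pi.add_apply, ← hx]
  rfl

lemma nodal_smul (z : Rd d) (c : ℂ) (v : V Ω ΓD ΓR) :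
    T.nodal z (c • v) = c * T.nodal z v := by
  unfold nodal
  rw [← mul_div_assoc, ← integral_const_mul]
  congr 1
  refine integral_congr_ae ?_
  filter_upwards [Lp.coeFn_smul c (fn v)] with x hx
  rw [← mul_assoc, ← smul_eq_mul c, ← Pi.smul_apply, ← hx]
  rfl

lemma interp_add (v w : V Ω ΓD ΓR) (x : Rd d) :
    T.interp (v + w) x = T.interp v x + T.interp w x := by
  simp [interp, nodal_add, add_mul, Finset.sum_add_distrib]

lemma interp_smul (c : ℂ) (v : V Ω ΓD ΓR) (x : Rd d) :
    T.interp (c • v) x = c * T.interp v x := by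
  simp [interp, nodal_smul, Finset.mul_sum, mul_assoc]

variable (ΓD ΓR) in
/-- The remainder space `W = ker I_H ⊆ V`. -/
def W : Submodule ℂ (V Ω ΓD ΓR) where
  carrier := {v | ∀ᵐ x ∂((volume : Measure (Rd d)).restrict Ω), T.interp v x = 0}
  zero_mem' := by
    rw [mem_ofPred_eq]
    refine Filter.Eventually.of_forall fun x => ?_
    simpa using T.interp_smul 0 (0 : V Ω ΓD ΓR) x
  add_mem' := by
    intro v w hv hw
    rw [mem_ofPred_eq] at hv hw ⊢
    filter_upwards [hv, hw] with x h k
    rw [interp_add, h, k, add_zero]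
  smul_mem' := by
    intro c v hv
    rw [mem_ofPred_eq] at hv ⊢
    filter_upwards [hv] with x h
    rw [interp_smul, h, mul_zero]

/-- The `L²`-norm over (the part inside the open set `Ω` of) the closed set `S`. -/
def normOn {F : Type} [NormedAddCommGroup F] (Ω S : Set (Rd d)) (f : Rd d → F) : ℝ :=
  √(∫ x in S ∩ Ω, ‖f x‖ ^ 2)

variable (ΓD ΓR) in
/-- `C_I` is an admissible constant in the local approximation and stability estimate
`H_s⁻¹ ‖v - I_H v‖_{L²(s)} + ‖∇(v - I_H v)‖_{L²(s)} ≤ C_I ‖∇v‖_{L²(Ω_{s,1})}`. -/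
def IsInterpolationConstant (CI : ℝ) : Prop :=
  ∀ v : V Ω ΓD ΓR, ∀ s ∈ T.elements,
    (Metric.diam (simplex s))⁻¹ * normOn Ω (simplex s) (fun x => fn v x - T.interp v x)
      + normOn Ω (simplex s) (fun x => grad v x - cgrad (T.interp v) x)
    ≤ CI * normOn Ω (T.patch s) (fun x => grad v x)

end Interpolation

end Mesh

end Helmholtz

end

/-!
For `w ∈ W` the interpolant vanishes, so the interpolation estimate becomes a local Poincaré
inequality `‖w‖_{L²(s)} ≤ C_I H_s ‖∇w‖_{L²(Ω_{s,1})}`. Almost every point lies in at most `C_ol`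
patches, hence summation over the elements and the resolution condition give
`κ² ‖w‖² ≤ 1/2 ‖∇w‖²`: on `W` the negative term of the form is absorbed by the gradient, and the
form is coercive.

Through `v ↦ (v, ∇v, v|_{Γ_D ∪ Γ_R})` the space `V` is a closed subspace of a Hilbert space on which
the form is given by a bounded diagonal operator, so the Lax–Milgram theorem on `W` yields the
correction operator. The trace is controlled by the energy norm because `Im a(v, v)` is `-κ ‖v‖²`
on the Robin boundary. Finally `a(ū, v̄) = a(v, u)` and `W` is stable under conjugation, so the
adjoint problem for `v` is the conjugate of the primal problem for `v̄`.
-/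

noncomputable section

namespace Helmholtz

section Measure

variable {X : Type*} [MeasurableSpace X] {μ : Measure X}

lemma sum_setIntegral_eq_integral_sum_indicator {ι E : Type*} [NormedAddCommGroup E]
    [NormedSpace ℝ E] {s : Finset ι} {A : ι → Set X} (hA : ∀ i ∈ s, MeasurableSet (A i))
    {f : X → E} (hf : Integrable f μ) :
    ∑ i ∈ s, ∫ x in A i, f x ∂μ = ∫ x, ∑ i ∈ s, (A i).indicator f x ∂μ := by
  rw [integral_finsetSum s fun i hi => hf.indicator (hA i hi)]
  exact Finset.sum_congr rfl fun i hi => (integral_indicator (hA i hi)).symm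

open Classical in
lemma sum_setIntegral_le_mul_integral {ι : Type*} {s : Finset ι} {A : ι → Set X}
    (hA : ∀ i ∈ s, MeasurableSet (A i)) {N : ℕ} (hN : ∀ᵐ x ∂μ, {i ∈ s | x ∈ A i}.card ≤ N)
    {f : X → ℝ} (hf : Integrable f μ) (hf0 : 0 ≤ f) :
    ∑ i ∈ s, ∫ x in A i, f x ∂μ ≤ N * ∫ x, f x ∂μ := by
  rw [sum_setIntegral_eq_integral_sum_indicator hA hf, ← integral_const_mul]
  refine integral_mono_ae (integrable_finsetSum s fun i hi => hf.indicator (hA i hi))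
    (hf.const_mul _) ?_
  filter_upwards [hN] with x hx
  rw [Finset.sum_indicator_eq_sum_filter, Finset.sum_const, nsmul_eq_mul]
  exact mul_le_mul_of_nonneg_right (mod_cast hx) (hf0 x)

lemma integral_le_sum_setIntegral {ι : Type*} {s : Finset ι} {A : ι → Set X}
    (hA : ∀ i ∈ s, MeasurableSet (A i)) (hcover : ∀ᵐ x ∂μ, ∃ i ∈ s, x ∈ A i)
    {f : X → ℝ} (hf : Integrable f μ) (hf0 : 0 ≤ f) :
    ∫ x, f x ∂μ ≤ ∑ i ∈ s, ∫ x in A i, f x ∂μ := by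
  rw [sum_setIntegral_eq_integral_sum_indicator hA hf]
  refine integral_mono_ae hf (integrable_finsetSum s fun i hi => hf.indicator (hA i hi)) ?_
  filter_upwards [hcover] with x ⟨i, hi, hxi⟩
  calc f x = (A i).indicator f x := (indicator_of_mem hxi f).symm
    _ ≤ ∑ j ∈ s, (A j).indicator f x :=
      Finset.single_le_sum (f := fun j => (A j).indicator f x)
        (fun j _ => indicator_nonneg (fun y _ => hf0 y) x) hi

lemma setIntegral_union_eq_right_of_ae_eq_zero {E : Type*} [NormedAddCommGroup E]
    [NormedSpace ℝ E] {s t : Set X} (hs : MeasurableSet s) {f : X → E}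
    (hf : ∀ᵐ x ∂μ.restrict (s ∪ t), x ∈ s → f x = 0) :
    ∫ x in s ∪ t, f x ∂μ = ∫ x in t, f x ∂μ := by
  have integral_eq_diff {r : Set X} (hr : r ⊆ s ∪ t) :
      ∫ x in r, f x ∂μ = ∫ x in sᶜ ∩ r, f x ∂μ := by
    rw [← Measure.restrict_restrict hs.compl, ← integral_indicator hs.compl]
    refine integral_congr_ae ?_
    filter_upwards [ae_restrict_of_ae_restrict_of_subset hr hf] with x hx
    by_cases hxs : x ∈ s
    · simp [hxs, hx hxs]
    · simp [hxs]
  rw [integral_eq_diff subset_rfl, integral_eq_diff subset_union_right, inter_union_distrib_left,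
    compl_inter_self, empty_union]

lemma integrable_norm_sq {F : Type*} [NormedAddCommGroup F] (f : Lp F 2 μ) :
    Integrable (fun x => ‖f x‖ ^ 2) μ :=
  (Lp.memLp f).integrable_norm_pow two_ne_zero

lemma norm_sq_eq_integral_norm_sq {F : Type*} [NormedAddCommGroup F] (f : Lp F 2 μ) :
    ‖f‖ ^ 2 = ∫ x, ‖f x‖ ^ 2 ∂μ := by
  have hint : 0 ≤ ∫ x, ‖f x‖ ^ 2 ∂μ := integral_nonneg fun x => sq_nonneg _
  rw [Lp.norm_def, (Lp.memLp f).eLpNorm_eq_integral_rpow_norm two_ne_zero ENNReal.ofNat_ne_top,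
    ENNReal.toReal_ofReal (by positivity)]
  simp only [ENNReal.toReal_ofNat, Real.rpow_two]
  rw [← one_div, ← Real.sqrt_eq_rpow, Real.sq_sqrt hint]

lemma continuous_integral_smul {𝕜 E : Type*} [RCLike 𝕜] [NormedAddCommGroup E] [NormedSpace ℝ E]
    [NormedSpace 𝕜 E] [SMulCommClass ℝ 𝕜 E] [CompleteSpace E] {p q : ℝ≥0∞} [Fact (1 ≤ p)]
    [Fact (1 ≤ q)] [ENNReal.HolderConjugate p q] {h : X → 𝕜} (hh : MemLp h p μ) :
    Continuous fun u : Lp E q μ => ∫ x, h x • u x ∂μ := by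
  have pairing_eq (u : Lp E q μ) :
      (ContinuousLinearMap.lsmul 𝕜 𝕜).lpPairing μ p q (hh.toLp h) u = ∫ x, h x • u x ∂μ := by
    rw [ContinuousLinearMap.lpPairing_eq_integral]
    refine integral_congr_ae ?_
    filter_upwards [hh.coeFn_toLp] with x hx
    rw [hx, ContinuousLinearMap.lsmul_apply]
  simp only [← pairing_eq]
  exact ContinuousLinearMap.continuous _

lemma isClosed_setOf_ae_eq {Y Z : Type*} [TopologicalSpace Y] [SequentialSpace Y]
    [TopologicalSpace Z] [T2Space Z] {f g : Y → X → Z} (hf : ∀ x, Continuous fun y => f y x)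
    (hg : ∀ x, Continuous fun y => g y x) : IsClosed {y | f y =ᵐ[μ] g y} := by
  refine IsSeqClosed.isClosed fun y y₀ hy hlim => ?_
  filter_upwards [ae_all_iff.mpr hy] with x hx
  exact tendsto_nhds_unique (((hf x).tendsto y₀).comp hlim)
    ((((hg x).tendsto y₀).comp hlim).congr fun n => (hx n).symm)

lemma isClosed_setOf_ae_mem_imp_eq_zero {F : Type*} [NormedAddCommGroup F] {p : ℝ≥0∞}
    [Fact (1 ≤ p)] (s : Set X) : IsClosed {f : Lp F p μ | ∀ᵐ x ∂μ, x ∈ s → f x = 0} := by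
  refine IsSeqClosed.isClosed fun f g hf hlim => ?_
  obtain ⟨ns, -, hns⟩ := (tendstoInMeasure_of_tendsto_Lp hlim).exists_seq_tendsto_ae
  filter_upwards [ae_all_iff.mpr hf, hns] with x hx hxlim hxs
  exact tendsto_nhds_unique hxlim (tendsto_const_nhds.congr fun n => (hx (ns n) hxs).symm)

end Measure

section LaxMilgram

variable {𝕜 E : Type*} [RCLike 𝕜] [NormedAddCommGroup E] [InnerProductSpace 𝕜 E]

theorem exists_continuousLinearMap_forall_inner_eq_iff (K : Submodule 𝕜 E) [CompleteSpace K]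
    (A : E →L[𝕜] E) {α : ℝ} (hα : 0 < α) (hA : ∀ w ∈ K, α * ‖w‖ ^ 2 ≤ ‖inner 𝕜 w (A w)‖) :
    ∃ C : E →L[𝕜] K, ∀ (v : E) (c : K),
      (∀ w ∈ K, inner 𝕜 w (A c) = inner 𝕜 w (A v)) ↔ c = C v := by
  let P : E →L[𝕜] K := K.orthogonalProjectionOnto
  have inner_P (w : K) (x : E) : inner 𝕜 w (P x) = inner 𝕜 (w : E) x :=
    K.inner_orthogonalProjectionOnto_eq_of_mem_left w x
  have isUnit_compression : IsUnit (P ∘L A ∘L K.subtypeL : K →L[𝕜] K) := by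
    refine ContinuousLinearMap.isUnit_of_forall_le_norm_inner_map _ (c := ⟨α, hα.le⟩) hα fun w => ?_
    calc ‖w‖ ^ 2 * α = α * ‖(w : E)‖ ^ 2 := by rw [mul_comm, Submodule.coe_norm]
      _ ≤ ‖inner 𝕜 (w : E) (A w)‖ := hA w w.2
      _ = ‖inner 𝕜 ((P ∘L A ∘L K.subtypeL) w) w‖ := by rw [← inner_P, norm_inner_symm]; rfl
  obtain ⟨U, hU⟩ := isUnit_compression
  let B : K ≃L[𝕜] K := ContinuousLinearEquiv.ofUnit U
  have B_apply (c : K) : B c = P (A c) := DFunLike.congr_fun hU c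
  refine ⟨B.symm ∘L P ∘L A, fun v c => ?_⟩
  calc (∀ w ∈ K, inner 𝕜 w (A c) = inner 𝕜 w (A v))
      ↔ ∀ w : K, inner 𝕜 w (P (A c)) = inner 𝕜 w (P (A v)) := by
        simp only [inner_P, Subtype.forall]
    _ ↔ B c = P (A v) := by rw [B_apply, ext_iff_inner_left 𝕜]
    _ ↔ c = B.symm (P (A v)) := B.eq_symm_apply.symm

theorem exists_linearMap_forall_inner_eq_iff {M : Type*} [AddCommGroup M] [Module 𝕜 M]
    {J : M →ₗ[𝕜] E} (hJ : Function.Injective J) (N : Submodule 𝕜 M) [CompleteSpace (N.map J)]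
    (A : E →L[𝕜] E) {α : ℝ} (hα : 0 < α)
    (hA : ∀ w ∈ N, α * ‖J w‖ ^ 2 ≤ ‖inner 𝕜 (J w) (A (J w))‖) :
    ∃ C : M →ₗ[𝕜] N, ∀ (v : M) (c : N),
      (∀ w ∈ N, inner 𝕜 (J w) (A (J c)) = inner 𝕜 (J w) (A (J v))) ↔ c = C v := by
  obtain ⟨C, hC⟩ := exists_continuousLinearMap_forall_inner_eq_iff (N.map J) A hα
    (by rintro _ ⟨w, hw, rfl⟩; exact hA w hw)
  let e : N ≃ₗ[𝕜] N.map J := N.equivMapOfInjective J hJ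
  refine ⟨e.symm.toLinearMap ∘ₗ C.toLinearMap ∘ₗ J, fun v c => ?_⟩
  have h := hC (J v) (e c)
  simp only [Submodule.mem_map, forall_exists_index, and_imp, forall_apply_eq_imp_iff₂] at h
  exact h.trans e.eq_symm_apply.symm

end LaxMilgram

lemma mul_sq_le_half_of_le_one_div {x c N : ℝ} (hx : 0 ≤ x) (hc : 0 < c) (hN : 0 ≤ N)
    (h : x ≤ 1 / (√(2 * N) * c)) : N * (x * c) ^ 2 ≤ 1 / 2 := by
  obtain rfl | hN := hN.eq_or_lt
  · norm_num
  have root_le_one : x * (√(2 * N) * c) ≤ 1 := (le_div_iff₀ (by positivity)).mp h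
  calc N * (x * c) ^ 2 = 1 / 2 * (x * (√(2 * N) * c)) ^ 2 := by
        rw [mul_pow x (_ * c), mul_pow √(2 * N), Real.sq_sqrt (by positivity)]
        ring
    _ ≤ 1 / 2 * 1 := by gcongr; exact pow_le_one₀ (by positivity) root_le_one
    _ = 1 / 2 := mul_one _

variable {d : ℕ}

namespace Mesh

lemma measurableSet_simplex (s : Finset (Rd d)) : MeasurableSet (simplex s) :=
  (isCompact_simplex s).measurableSet

section Geometry

variable {Ω : Set (Rd d)} (T : Mesh Ω)

lemma diam_simplex_le_size {s : Finset (Rd d)} (hs : s ∈ T.elements) :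
    Metric.diam (simplex s) ≤ T.size :=
  le_ciSup (f := fun s : T.elements => Metric.diam (simplex s.1)) (finite_range _).bddAbove ⟨s, hs⟩

lemma size_nonneg : 0 ≤ T.size :=
  Real.iSup_nonneg fun _ => Metric.diam_nonneg

lemma diam_simplex_pos (hd : 1 ≤ d) {s : Finset (Rd d)} (hs : s ∈ T.elements) :
    0 < Metric.diam (simplex s) := by
  obtain ⟨a, ha, b, hb, hab⟩ := Finset.one_lt_card.mp (by rw [T.card_eq s hs]; lia)
  exact (dist_pos.mpr hab).trans_le (Metric.dist_le_diam_of_mem (isCompact_simplex s).isBounded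
    (subset_convexHull ℝ _ ha) (subset_convexHull ℝ _ hb))

lemma mem_patch {s : Finset (Rd d)} {x : Rd d} :
    x ∈ T.patch s ↔ ∃ t ∈ T.elements, (simplex t ∩ simplex s).Nonempty ∧ x ∈ simplex t := by
  simp [patch, and_assoc]

lemma simplex_subset_patch {s t : Finset (Rd d)} (ht : t ∈ T.elements)
    (hts : (simplex t ∩ simplex s).Nonempty) : simplex t ⊆ T.patch s :=
  fun _ hx => T.mem_patch.mpr ⟨t, ht, hts, hx⟩

lemma measurableSet_patch (s : Finset (Rd d)) : MeasurableSet (T.patch s) :=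
  Finset.measurableSet_biUnion _ fun t _ => measurableSet_simplex t

open Classical in
lemma card_inter_lt {s t : Finset (Rd d)} (hs : s ∈ T.elements) (ht : t ∈ T.elements)
    (hst : s ≠ t) : (s ∩ t).card < d + 1 := by
  refine (T.card_eq s hs) ▸ Finset.card_lt_card ?_
  refine Finset.ssubset_iff_subset_ne.mpr ⟨Finset.inter_subset_left, fun h => hst ?_⟩
  exact Finset.eq_of_subset_of_card_le (Finset.inter_eq_left.mp h)
    (by rw [T.card_eq s hs, T.card_eq t ht])

lemma volume_simplex_inter_eq_zero {s t : Finset (Rd d)} (hs : s ∈ T.elements)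
    (ht : t ∈ T.elements) (hst : s ≠ t) : volume (simplex s ∩ simplex t) = 0 := by
  classical
  have subset_span : simplex s ∩ simplex t ⊆
      (affineSpan ℝ ((s ∩ t : Finset (Rd d)) : Set (Rd d)) : Set (Rd d)) := by
    rw [Finset.coe_inter]
    exact (T.inter_subset s hs t ht).trans (convexHull_subset_affineSpan _)
  refine measure_mono_null subset_span ?_
  refine Measure.addHaar_affineSubspace volume _ fun span_eq_top => ?_
  have indep : AffineIndependent ℝ ((↑) : (s ∩ t : Finset (Rd d)) → Rd d) :=
    (T.indep s hs).mono (by simp)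
  have card_eq : (s ∩ t).card = d + 1 := by
    have range_eq : range ((↑) : (s ∩ t : Finset (Rd d)) → Rd d) =
        ((s ∩ t : Finset (Rd d)) : Set (Rd d)) :=
      Subtype.range_coe
    rw [← range_eq, indep.affineSpan_eq_top_iff_card_eq_finrank_add_one] at span_eq_top
    simpa using span_eq_top
  exact (T.card_inter_lt hs ht hst).ne card_eq

lemma ae_eq_of_mem_simplex_of_mem_simplex :
    ∀ᵐ x ∂(volume : Measure (Rd d)), ∀ s ∈ T.elements, ∀ t ∈ T.elements,
      x ∈ simplex s → x ∈ simplex t → s = t := by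
  refine (Finset.eventually_all _).mpr fun s hs => (Finset.eventually_all _).mpr fun t ht => ?_
  by_cases hst : s = t
  · exact .of_forall fun _ _ _ => hst
  · filter_upwards [measure_eq_zero_iff_ae_notMem.mp (T.volume_simplex_inter_eq_zero hs ht hst)]
      with x hx hxs hxt
    exact absurd ⟨hxs, hxt⟩ hx

open Classical in
lemma card_filter_mem_patch_le_overlap {x : Rd d}
    (hx : ∀ s ∈ T.elements, ∀ t ∈ T.elements, x ∈ simplex s → x ∈ simplex t → s = t) :
    {s ∈ T.elements | x ∈ T.patch s}.card ≤ T.overlap := by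
  obtain h_empty | ⟨s₀, hs₀⟩ := {s ∈ T.elements | x ∈ T.patch s}.eq_empty_or_nonempty
  · rw [h_empty]
    exact Nat.zero_le _
  obtain ⟨t, ht, -, hxt⟩ := T.mem_patch.mp (Finset.mem_filter.mp hs₀).2
  have subset_patch (s : Finset (Rd d)) (hs : s ∈ T.elements) (hxs : x ∈ T.patch s) :
      simplex s ⊆ T.patch t := by
    obtain ⟨t', ht', hmeet, hxt'⟩ := T.mem_patch.mp hxs
    obtain rfl := hx t ht t' ht' hxt hxt'
    exact T.simplex_subset_patch hs (inter_comm _ _ ▸ hmeet)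
  calc {s ∈ T.elements | x ∈ T.patch s}.card
      ≤ {s ∈ T.elements | simplex s ⊆ T.patch t}.card :=
        Finset.card_le_card fun s hs => by
          simp only [Finset.mem_filter] at hs ⊢
          exact ⟨hs.1, subset_patch s hs.1 hs.2⟩
    _ ≤ T.overlap :=
        Finset.le_sup (f := fun t => {s ∈ T.elements | simplex s ⊆ T.patch t}.card) ht

lemma ae_restrict_exists_mem_simplex :
    ∀ᵐ x ∂(volume.restrict Ω), ∃ s ∈ T.elements, x ∈ simplex s := by
  filter_upwards [ae_restrict_of_ae_restrict_of_subset subset_closure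
    (ae_restrict_mem (μ := volume) isClosed_closure.measurableSet)] with x hx
  simpa [← T.cover, simplex] using hx

end Geometry

section LocalNorms

variable {Ω : Set (Rd d)} {F : Type} [NormedAddCommGroup F]

lemma normOn_nonneg (Ω S : Set (Rd d)) (f : Rd d → F) : 0 ≤ normOn Ω S f := Real.sqrt_nonneg _

lemma normOn_sq {S : Set (Rd d)} (hS : MeasurableSet S) (f : Rd d → F) :
    normOn Ω S f ^ 2 = ∫ x in S, ‖f x‖ ^ 2 ∂(volume.restrict Ω) := by
  rw [normOn, Real.sq_sqrt (integral_nonneg fun x => sq_nonneg _), Measure.restrict_restrict hS]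

lemma normOn_congr_ae (S : Set (Rd d)) {f g : Rd d → F} (h : f =ᵐ[volume.restrict Ω] g) :
    normOn Ω S f = normOn Ω S g := by
  refine congrArg Real.sqrt (integral_congr_ae ?_)
  filter_upwards [ae_restrict_of_ae_restrict_of_subset inter_subset_right h] with x hx
  rw [hx]

variable (T : Mesh Ω)

lemma norm_sq_le_sum_normOn_simplex_sq (f : Lp F 2 ((volume : Measure (Rd d)).restrict Ω)) :
    ‖f‖ ^ 2 ≤ ∑ s ∈ T.elements, normOn Ω (simplex s) f ^ 2 := by
  simp only [norm_sq_eq_integral_norm_sq, normOn_sq (measurableSet_simplex _)]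
  exact integral_le_sum_setIntegral (fun s _ => measurableSet_simplex s)
    T.ae_restrict_exists_mem_simplex (integrable_norm_sq f) fun x => sq_nonneg _

lemma sum_normOn_patch_sq_le (f : Lp F 2 ((volume : Measure (Rd d)).restrict Ω)) :
    ∑ s ∈ T.elements, normOn Ω (T.patch s) f ^ 2 ≤ T.overlap * ‖f‖ ^ 2 := by
  simp only [norm_sq_eq_integral_norm_sq, normOn_sq (T.measurableSet_patch _)]
  refine sum_setIntegral_le_mul_integral (fun s _ => T.measurableSet_patch s) ?_
    (integrable_norm_sq f) fun x => sq_nonneg _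
  filter_upwards [ae_restrict_of_ae T.ae_eq_of_mem_simplex_of_mem_simplex] with x hx
  exact T.card_filter_mem_patch_le_overlap hx

end LocalNorms

section Poincare

variable {Ω ΓD ΓR : Set (Rd d)} {T : Mesh Ω} {CI : ℝ}

lemma IsInterpolationConstant.normOn_fn_le (hI : T.IsInterpolationConstant ΓD ΓR CI) (hd : 1 ≤ d)
    {w : V Ω ΓD ΓR} (hw : w ∈ T.W ΓD ΓR) {s : Finset (Rd d)} (hs : s ∈ T.elements) :
    normOn Ω (simplex s) (fn w) ≤
      Metric.diam (simplex s) * (CI * normOn Ω (T.patch s) (grad w)) := by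
  have interp_eq_zero : ∀ᵐ x ∂(volume.restrict Ω), T.interp w x = 0 := hw
  have fn_eq : fn w =ᵐ[volume.restrict Ω] fun x => fn w x - T.interp w x := by
    filter_upwards [interp_eq_zero] with x hx
    rw [hx, sub_zero]
  rw [normOn_congr_ae _ fn_eq, ← inv_mul_le_iff₀ (T.diam_simplex_pos hd hs)]
  exact (le_add_of_nonneg_right (normOn_nonneg _ _ _)).trans (hI w s hs)

lemma IsInterpolationConstant.norm_fn_sq_le (hI : T.IsInterpolationConstant ΓD ΓR CI) (hd : 1 ≤ d)
    {w : V Ω ΓD ΓR} (hw : w ∈ T.W ΓD ΓR) :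
    ‖fn w‖ ^ 2 ≤ (T.size * CI) ^ 2 * (T.overlap * ‖grad w‖ ^ 2) := by
  have local_le (s : Finset (Rd d)) (hs : s ∈ T.elements) :
      normOn Ω (simplex s) (fn w) ^ 2 ≤
        (T.size * CI) ^ 2 * normOn Ω (T.patch s) (grad w) ^ 2 := by
    calc normOn Ω (simplex s) (fn w) ^ 2
        ≤ (Metric.diam (simplex s) * (CI * normOn Ω (T.patch s) (grad w))) ^ 2 :=
          pow_le_pow_left₀ (normOn_nonneg _ _ _) (hI.normOn_fn_le hd hw hs) 2
      _ = Metric.diam (simplex s) ^ 2 * (CI ^ 2 * normOn Ω (T.patch s) (grad w) ^ 2) := by ring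
      _ ≤ T.size ^ 2 * (CI ^ 2 * normOn Ω (T.patch s) (grad w) ^ 2) := by
          gcongr
          exact T.diam_simplex_le_size hs
      _ = (T.size * CI) ^ 2 * normOn Ω (T.patch s) (grad w) ^ 2 := by ring
  calc ‖fn w‖ ^ 2 ≤ ∑ s ∈ T.elements, normOn Ω (simplex s) (fn w) ^ 2 :=
        T.norm_sq_le_sum_normOn_simplex_sq (fn w)
    _ ≤ ∑ s ∈ T.elements, (T.size * CI) ^ 2 * normOn Ω (T.patch s) (grad w) ^ 2 :=
        Finset.sum_le_sum local_le
    _ = (T.size * CI) ^ 2 * ∑ s ∈ T.elements, normOn Ω (T.patch s) (grad w) ^ 2 :=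
        (Finset.mul_sum ..).symm
    _ ≤ (T.size * CI) ^ 2 * (T.overlap * ‖grad w‖ ^ 2) := by
        gcongr
        exact T.sum_normOn_patch_sq_le (grad w)

lemma IsInterpolationConstant.sq_mul_norm_fn_sq_le (hI : T.IsInterpolationConstant ΓD ΓR CI)
    (hd : 1 ≤ d) {κ : ℝ} (hκ : 0 ≤ κ) (hCI : 0 < CI)
    (hres : T.size * κ ≤ 1 / (√(2 * (T.overlap : ℝ)) * CI)) {w : V Ω ΓD ΓR}
    (hw : w ∈ T.W ΓD ΓR) : κ ^ 2 * ‖fn w‖ ^ 2 ≤ 1 / 2 * ‖grad w‖ ^ 2 := by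
  calc κ ^ 2 * ‖fn w‖ ^ 2
      ≤ κ ^ 2 * ((T.size * CI) ^ 2 * (T.overlap * ‖grad w‖ ^ 2)) := by
        gcongr
        exact hI.norm_fn_sq_le hd hw
    _ = T.overlap * (T.size * κ * CI) ^ 2 * ‖grad w‖ ^ 2 := by ring
    _ ≤ 1 / 2 * ‖grad w‖ ^ 2 := by
        gcongr
        exact mul_sq_le_half_of_le_one_div (mul_nonneg T.size_nonneg hκ) hCI
          (Nat.cast_nonneg _) hres

end Poincare

end Mesh

variable {Ω ΓD ΓR : Set (Rd d)}

section Form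

variable {κ Ca : ℝ}

lemma normV_nonneg (κ : ℝ) (v : V Ω ΓD ΓR) : 0 ≤ normV κ v := Real.sqrt_nonneg _

lemma normV_sq (κ : ℝ) (v : V Ω ΓD ΓR) :
    normV κ v ^ 2 = κ ^ 2 * ‖fn v‖ ^ 2 + ‖grad v‖ ^ 2 := Real.sq_sqrt (by positivity)

lemma norm_grad_le_normV (κ : ℝ) (v : V Ω ΓD ΓR) : ‖grad v‖ ≤ normV κ v :=
  Real.le_sqrt_of_sq_le (le_add_of_nonneg_left (by positivity))

lemma normV_le_sqrt_mul_norm_grad {θ : ℝ} {v : V Ω ΓD ΓR}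
    (hv : κ ^ 2 * ‖fn v‖ ^ 2 ≤ θ * ‖grad v‖ ^ 2) : normV κ v ≤ √(1 + θ) * ‖grad v‖ := by
  rw [normV, ← Real.sqrt_sq (norm_nonneg (grad v)), ← Real.sqrt_mul' _ (sq_nonneg _),
    Real.sqrt_sq (norm_nonneg (grad v))]
  exact Real.sqrt_le_sqrt (by linarith)

lemma setIntegral_tr_mul_conj_tr (hD : MeasurableSet ΓD) (u v : V Ω ΓD ΓR) :
    ∫ x in ΓR, tr u x * conj (tr v x) ∂(surface d) = inner ℂ (tr v) (tr u) := by
  rw [L2.inner_def, setIntegral_union_eq_right_of_ae_eq_zero hD]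
  · simp only [RCLike.inner_apply]
  · filter_upwards [u.2.2.2] with x hx hxD
    have tr_eq_zero : tr u x = 0 := hx hxD
    rw [tr_eq_zero, inner_zero_right]

lemma form_eq_inner (hD : MeasurableSet ΓD) (κ : ℝ) (u v : V Ω ΓD ΓR) :
    form κ u v = inner ℂ (grad v) (grad u) - (κ : ℂ) ^ 2 * inner ℂ (fn v) (fn u)
      - Complex.I * (κ : ℂ) * inner ℂ (tr v) (tr u) := by
  simp only [form, setIntegral_tr_mul_conj_tr hD, L2.inner_def (grad v), L2.inner_def (fn v),
    PiLp.inner_apply, RCLike.inner_apply]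

lemma form_self_re (hD : MeasurableSet ΓD) (κ : ℝ) (u : V Ω ΓD ΓR) :
    (form κ u u).re = ‖grad u‖ ^ 2 - κ ^ 2 * ‖fn u‖ ^ 2 := by
  simp [form_eq_inner hD, inner_self_eq_norm_sq_to_K, ← Complex.ofReal_pow]

lemma form_self_im (hD : MeasurableSet ΓD) (κ : ℝ) (u : V Ω ΓD ΓR) :
    (form κ u u).im = -(κ * ‖tr u‖ ^ 2) := by
  simp [form_eq_inner hD, inner_self_eq_norm_sq_to_K, ← Complex.ofReal_pow]

lemma mul_normV_sq_le_mul_form_self_re (hD : MeasurableSet ΓD) {θ : ℝ} {v : V Ω ΓD ΓR}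
    (hv : κ ^ 2 * ‖fn v‖ ^ 2 ≤ θ * ‖grad v‖ ^ 2) :
    (1 - θ) * normV κ v ^ 2 ≤ (1 + θ) * (form κ v v).re := by
  rw [form_self_re hD, normV_sq]
  linarith

lemma IsContinuityConstant.mul_normV_nonneg (hCa : IsContinuityConstant Ω ΓD ΓR κ Ca)
    (v : V Ω ΓD ΓR) : 0 ≤ Ca * normV κ v := by
  obtain hv | hv := (normV_nonneg κ v).eq_or_lt
  · rw [← hv, mul_zero]
  · exact nonneg_of_mul_nonneg_left ((norm_nonneg _).trans (hCa v v)) hv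

lemma IsContinuityConstant.mul_norm_tr_sq_le (hCa : IsContinuityConstant Ω ΓD ΓR κ Ca)
    (hD : MeasurableSet ΓD) (v : V Ω ΓD ΓR) : κ * ‖tr v‖ ^ 2 ≤ Ca * normV κ v ^ 2 := by
  calc κ * ‖tr v‖ ^ 2 ≤ |(form κ v v).im| := by
        rw [form_self_im hD, abs_neg]
        exact le_abs_self _
    _ ≤ ‖form κ v v‖ := Complex.abs_im_le_norm _
    _ ≤ Ca * normV κ v * normV κ v := hCa v v
    _ = Ca * normV κ v ^ 2 := by ring

lemma IsContinuityConstant.mul_normV_le (hCa : IsContinuityConstant Ω ΓD ΓR κ Ca) {α : ℝ}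
    {c v : V Ω ΓD ΓR} (hc : α * normV κ c ^ 2 ≤ ‖form κ c c‖) (h : form κ c c = form κ v c) :
    α * normV κ c ≤ Ca * normV κ v := by
  obtain hc0 | hc0 := (normV_nonneg κ c).eq_or_lt
  · rw [← hc0, mul_zero]
    exact hCa.mul_normV_nonneg v
  · refine le_of_mul_le_mul_right ?_ hc0
    calc α * normV κ c * normV κ c = α * normV κ c ^ 2 := by ring
      _ ≤ ‖form κ v c‖ := h ▸ hc
      _ ≤ Ca * normV κ v * normV κ c := hCa v c

end Form

section Closedness

lemma isClosed_setOf_isWeakGradient (Ω : Set (Rd d)) :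
    IsClosed {p : L2 Ω × L2vec Ω | IsWeakGradient Ω p.1 p.2} := by
  simp only [IsWeakGradient, ofPred_forall]
  refine isClosed_iInter fun φ => isClosed_iInter fun hφ => isClosed_iInter fun hc =>
    isClosed_iInter fun _ => isClosed_iInter fun i => ?_
  have continuous_testing {ψ : Rd d → ℝ} (hψ : Continuous ψ) (hψc : HasCompactSupport ψ) :
      Continuous fun u : L2 Ω => ∫ x in Ω, ψ x • u x :=
    continuous_integral_smul (p := 2) ((hψ.memLp_of_hasCompactSupport hψc).restrict Ω)
  refine isClosed_eq ?_ (Continuous.neg ?_)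
  · exact (continuous_testing (continuous_pderiv hφ i) (hasCompactSupport_pderiv hc i)).comp
      continuous_fst
  · let coord : L2vec Ω →L[ℂ] L2 Ω := (EuclideanSpace.proj i).compLpL 2 _
    refine ((continuous_testing hφ.continuous hc).comp
      (coord.continuous.comp continuous_snd)).congr fun p => integral_congr_ae ?_
    filter_upwards [(EuclideanSpace.proj i : Cd d →L[ℂ] ℂ).coeFn_compLpL p.2] with x hx
    rw [Function.comp_apply, hx, EuclideanSpace.coe_proj]

lemma isClosed_V (Ω ΓD ΓR : Set (Rd d)) :
    IsClosed (V Ω ΓD ΓR : Set (L2 Ω × L2vec Ω × L2bdry (ΓD ∪ ΓR))) := by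
  refine IsClosed.inter ?_ (IsClosed.inter ?_ ?_)
  · exact (isClosed_setOf_isWeakGradient Ω).preimage
      (continuous_fst.prodMk (continuous_fst.comp continuous_snd))
  · exact Submodule.isClosed_topologicalClosure _
  · exact (isClosed_setOf_ae_mem_imp_eq_zero ΓD).preimage (continuous_snd.comp continuous_snd)

lemma Mesh.continuous_nodal (T : Mesh Ω) (z : Rd d) :
    Continuous fun v : V Ω ΓD ΓR => T.nodal z v := by
  have continuous_fn : Continuous (fn : V Ω ΓD ΓR → L2 Ω) :=
    continuous_fst.comp continuous_subtype_val
  simpa only [nodal, smul_eq_mul, mul_comm, Function.comp_def] using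
    ((continuous_integral_smul (T.memLp_hat z)).comp continuous_fn).div_const _

lemma Mesh.isClosed_W (T : Mesh Ω) : IsClosed (T.W ΓD ΓR : Set (V Ω ΓD ΓR)) :=
  isClosed_setOf_ae_eq
    (fun _ => continuous_finsetSum _ fun z _ => (T.continuous_nodal z).mul continuous_const)
    fun _ => continuous_const

end Closedness

section HilbertSpace

/-- The Hilbert space `L²(Ω) ⊕ L²(Ω)^d ⊕ L²(S)`. It replaces the product of the three spaces, which
carries the maximum norm. -/
abbrev Hilb (Ω S : Set (Rd d)) : Type := WithLp 2 (L2 Ω × WithLp 2 (L2vec Ω × L2bdry S))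

/-- The identity map from the product of the three `L²` spaces to the Hilbert space `Hilb Ω S`. -/
def toHilb (Ω S : Set (Rd d)) : (L2 Ω × L2vec Ω × L2bdry S) ≃L[ℂ] Hilb Ω S :=
  ((ContinuousLinearEquiv.refl ℂ (L2 Ω)).prodCongr
    (WithLp.prodContinuousLinearEquiv 2 ℂ (L2vec Ω) (L2bdry S)).symm).trans
    (WithLp.prodContinuousLinearEquiv 2 ℂ (L2 Ω) (WithLp 2 (L2vec Ω × L2bdry S))).symm

/-- The embedding `v ↦ (v, ∇v, v|_{Γ_D ∪ Γ_R})` of `V` into a Hilbert space, on which the Helmholtz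
form is represented by a bounded operator. -/
def embed (Ω ΓD ΓR : Set (Rd d)) : V Ω ΓD ΓR →ₗ[ℂ] Hilb Ω (ΓD ∪ ΓR) :=
  (toHilb Ω (ΓD ∪ ΓR)).toLinearMap ∘ₗ (V Ω ΓD ΓR).subtype

/-- The diagonal operator `diag(-κ², 1, -iκ)`, which represents the Helmholtz form. -/
def helmholtzOp (Ω S : Set (Rd d)) (κ : ℝ) : Hilb Ω S →L[ℂ] Hilb Ω S where
  toFun p := WithLp.toLp 2
    (-(κ : ℂ) ^ 2 • p.fst, WithLp.toLp 2 (p.snd.fst, -(Complex.I * κ) • p.snd.snd))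
  map_add' p q := by simp only [WithLp.add_fst, WithLp.add_snd, smul_add]; rfl
  map_smul' c p := by
    simp only [WithLp.smul_fst, WithLp.smul_snd, RingHom.id_apply, smul_comm _ c]; rfl
  cont := by fun_prop

lemma embed_injective : Function.Injective (embed Ω ΓD ΓR) :=
  (toHilb Ω (ΓD ∪ ΓR)).injective.comp Subtype.val_injective

lemma isClosed_map_embed {N : Submodule ℂ (V Ω ΓD ΓR)} (hN : IsClosed (N : Set (V Ω ΓD ΓR))) :
    IsClosed (N.map (embed Ω ΓD ΓR) : Set (Hilb Ω (ΓD ∪ ΓR))) :=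
  ((toHilb Ω (ΓD ∪ ΓR)).toHomeomorph.isClosedEmbedding.comp
    (isClosed_V Ω ΓD ΓR).isClosedEmbedding_subtypeVal).isClosedMap _ hN

lemma norm_embed_sq (v : V Ω ΓD ΓR) :
    ‖embed Ω ΓD ΓR v‖ ^ 2 = ‖fn v‖ ^ 2 + (‖grad v‖ ^ 2 + ‖tr v‖ ^ 2) := by
  rw [WithLp.prod_norm_sq_eq_of_L2, WithLp.prod_norm_sq_eq_of_L2]
  rfl

lemma form_eq_inner_helmholtzOp (hD : MeasurableSet ΓD) (κ : ℝ) (u v : V Ω ΓD ΓR) :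
    form κ u v = inner ℂ (embed Ω ΓD ΓR v) (helmholtzOp Ω (ΓD ∪ ΓR) κ (embed Ω ΓD ΓR u)) := by
  have inner_eq : inner ℂ (embed Ω ΓD ΓR v) (helmholtzOp Ω (ΓD ∪ ΓR) κ (embed Ω ΓD ΓR u)) =
      inner ℂ (fn v) (-(κ : ℂ) ^ 2 • fn u) +
        (inner ℂ (grad v) (grad u) + inner ℂ (tr v) (-(Complex.I * κ) • tr u)) := by
    rw [WithLp.prod_inner_apply, WithLp.prod_inner_apply]
    rfl
  rw [inner_eq, form_eq_inner hD, inner_smul_right, inner_smul_right]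
  ring

lemma IsContinuityConstant.norm_embed_sq_le {κ Ca : ℝ} (hCa : IsContinuityConstant Ω ΓD ΓR κ Ca)
    (hD : MeasurableSet ΓD) (hκ : 0 < κ) (v : V Ω ΓD ΓR) :
    ‖embed Ω ΓD ΓR v‖ ^ 2 ≤ ((κ ^ 2)⁻¹ + 1 + |Ca| / κ) * normV κ v ^ 2 := by
  have fn_le : ‖fn v‖ ^ 2 ≤ (κ ^ 2)⁻¹ * normV κ v ^ 2 := by
    rw [le_inv_mul_iff₀ (by positivity), normV_sq]
    exact le_add_of_nonneg_right (sq_nonneg _)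
  have grad_le : ‖grad v‖ ^ 2 ≤ normV κ v ^ 2 :=
    pow_le_pow_left₀ (norm_nonneg _) (norm_grad_le_normV κ v) 2
  have tr_le : ‖tr v‖ ^ 2 ≤ |Ca| / κ * normV κ v ^ 2 := by
    rw [div_mul_eq_mul_div, le_div_iff₀' hκ]
    exact (hCa.mul_norm_tr_sq_le hD v).trans
      (mul_le_mul_of_nonneg_right (le_abs_self Ca) (sq_nonneg _))
  rw [norm_embed_sq]
  linarith

theorem exists_correction (hD : MeasurableSet ΓD) {κ Ca : ℝ} (hκ : 0 < κ)
    (hCa : IsContinuityConstant Ω ΓD ΓR κ Ca) {N : Submodule ℂ (V Ω ΓD ΓR)}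
    (hN : IsClosed (N : Set (V Ω ΓD ΓR))) {α : ℝ} (hα : 0 < α)
    (hcoercive : ∀ w ∈ N, α * normV κ w ^ 2 ≤ ‖form κ w w‖) :
    ∃ C : V Ω ΓD ΓR →ₗ[ℂ] N, ∀ (v : V Ω ΓD ΓR) (c : N),
      (∀ w ∈ N, form κ c w = form κ v w) ↔ c = C v := by
  have : CompleteSpace (N.map (embed Ω ΓD ΓR)) := (isClosed_map_embed hN).completeSpace_coe
  simp only [form_eq_inner_helmholtzOp hD] at hcoercive ⊢
  set K : ℝ := (κ ^ 2)⁻¹ + 1 + |Ca| / κ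
  have K_pos : 0 < K := by positivity
  refine exists_linearMap_forall_inner_eq_iff embed_injective N _ (div_pos hα K_pos)
    fun w hw => le_trans ?_ (hcoercive w hw)
  rw [div_mul_eq_mul_div, div_le_iff₀' K_pos, mul_left_comm]
  exact mul_le_mul_of_nonneg_left (hCa.norm_embed_sq_le hD hκ w) hα.le

end HilbertSpace

section Conjugation

variable {S : Set (Rd d)}

/-- Pointwise complex conjugation on `L²(μ)`. -/
def conjLp {X : Type*} [MeasurableSpace X] (μ : Measure X) : Lp ℂ 2 μ →L⋆[ℂ] Lp ℂ 2 μ :=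
  ((starL ℂ : ℂ ≃L⋆[ℂ] ℂ) : ℂ →L⋆[ℂ] ℂ).compLpL 2 μ

lemma coeFn_conjLp {X : Type*} [MeasurableSpace X] {μ : Measure X} (f : Lp ℂ 2 μ) :
    conjLp μ f =ᵐ[μ] fun x => conj (f x) :=
  ((starL ℂ : ℂ ≃L⋆[ℂ] ℂ) : ℂ →L⋆[ℂ] ℂ).coeFn_compLpL f

/-- Componentwise complex conjugation on `ℂ^d`. -/
def conjCd (d : ℕ) : Cd d →L⋆[ℂ] Cd d where
  toFun x := WithLp.toLp 2 fun i => conj (x i)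
  map_add' x y := by ext i; simp
  map_smul' c x := by ext i; simp
  cont := by fun_prop

lemma conjCd_apply (x : Cd d) (i : Fin d) : conjCd d x i = conj (x i) := rfl

/-- Pointwise complex conjugation of a function on `Ω`, a vector field on `Ω` and a function on
`S`. -/
def conjTriple (Ω S : Set (Rd d)) :
    (L2 Ω × L2vec Ω × L2bdry S) →L⋆[ℂ] L2 Ω × L2vec Ω × L2bdry S where
  toFun p := (conjLp _ p.1, (conjCd d).compLpL 2 _ p.2.1, conjLp _ p.2.2)
  map_add' p q := by simp only [Prod.fst_add, Prod.snd_add, map_add, Prod.mk_add_mk]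
  map_smul' c p := by simp only [Prod.smul_fst, Prod.smul_snd, map_smulₛₗ, Prod.smul_mk]
  cont := by fun_prop

lemma IsWeakGradient.conj {u : L2 Ω} {G : L2vec Ω} (h : IsWeakGradient Ω u G) :
    IsWeakGradient Ω (conjLp _ u) ((conjCd d).compLpL 2 _ G) := by
  intro φ hφ hc hs i
  calc ∫ x in Ω, pderiv i φ x • conjLp _ u x
      = ∫ x in Ω, starRingEnd ℂ (pderiv i φ x • u x) := by
        refine integral_congr_ae ?_
        filter_upwards [coeFn_conjLp u] with x hx
        simp [hx]
    _ = -∫ x in Ω, starRingEnd ℂ (φ x • G x i) := by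
        rw [integral_conj, integral_conj, h φ hφ hc hs i, map_neg]
    _ = -∫ x in Ω, φ x • ((conjCd d).compLpL 2 _ G x) i := by
        refine congrArg Neg.neg (integral_congr_ae ?_)
        filter_upwards [(conjCd d).coeFn_compLpL G] with x hx
        rw [hx, conjCd_apply, Complex.real_smul, Complex.real_smul, map_mul, Complex.conj_ofReal]

lemma cgrad_conj {φ : Rd d → ℂ} {x : Rd d} (hφ : DifferentiableAt ℝ φ x) :
    cgrad (fun y => conj (φ y)) x = conjCd d (cgrad φ x) := by
  have hasFDerivAt_conj : HasFDerivAt (fun y => conj (φ y))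
      ((Complex.conjCLE : ℂ →L[ℝ] ℂ).comp (fderiv ℝ φ x)) x :=
    (Complex.conjCLE : ℂ →L[ℝ] ℂ).hasFDerivAt.comp x hφ.hasFDerivAt
  ext i
  rw [conjCd_apply]
  simp [cgrad, pderiv, hasFDerivAt_conj.fderiv]

lemma conjTriple_mem_traceGraph {p : L2 Ω × L2vec Ω × L2bdry S} (hp : p ∈ traceGraph Ω S) :
    conjTriple Ω S p ∈ traceGraph Ω S := by
  refine map_mem_closure (conjTriple Ω S).continuous hp ?_
  rintro q ⟨φ, hφ, fn_eq, grad_eq, tr_eq⟩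
  refine ⟨fun y => conj (φ y), Complex.conjCLE.contDiff.comp hφ, ?_, ?_, ?_⟩
  · filter_upwards [coeFn_conjLp q.1, fn_eq] with x hx hφx
    exact hx.trans (congrArg conj hφx)
  · filter_upwards [(conjCd d).coeFn_compLpL q.2.1, grad_eq] with x hx hφx
    rw [cgrad_conj (hφ.differentiable (by simp) x), ← hφx]
    exact hx
  · filter_upwards [coeFn_conjLp q.2.2, tr_eq] with x hx hφx
    exact hx.trans (congrArg conj hφx)

lemma conjTriple_mem_V {p : L2 Ω × L2vec Ω × L2bdry (ΓD ∪ ΓR)} (hp : p ∈ V Ω ΓD ΓR) :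
    conjTriple Ω (ΓD ∪ ΓR) p ∈ V Ω ΓD ΓR := by
  obtain ⟨weakGradient, mem_traceGraph, tr_eq_zero⟩ := hp
  refine ⟨weakGradient.conj, conjTriple_mem_traceGraph mem_traceGraph, ?_⟩
  filter_upwards [coeFn_conjLp p.2.2, tr_eq_zero] with x hx hx0 hxD
  exact hx.trans (by rw [hx0 hxD, map_zero])

/-- Complex conjugation on `V`. -/
def conjV (Ω ΓD ΓR : Set (Rd d)) : V Ω ΓD ΓR →ₗ⋆[ℂ] V Ω ΓD ΓR where
  toFun v := ⟨conjTriple Ω (ΓD ∪ ΓR) v, conjTriple_mem_V v.2⟩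
  map_add' v w := Subtype.ext (map_add (conjTriple Ω (ΓD ∪ ΓR)) v.1 w.1)
  map_smul' c v := Subtype.ext (map_smulₛₗ (conjTriple Ω (ΓD ∪ ΓR)) c v.1)

lemma isConj_conjV (v : V Ω ΓD ΓR) : IsConj v (conjV Ω ΓD ΓR v) := by
  refine ⟨coeFn_conjLp (fn v), ?_, coeFn_conjLp (tr v)⟩
  filter_upwards [(conjCd d).coeFn_compLpL (grad v)] with x hx i
  exact congrArg (fun y : Cd d => y i) hx

lemma IsConj.symm {v v' : V Ω ΓD ΓR} (h : IsConj v v') : IsConj v' v := by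
  refine ⟨h.1.mono fun x hx => ?_, h.2.1.mono fun x hx i => ?_, h.2.2.mono fun x hx => ?_⟩
  · rw [hx, Complex.conj_conj]
  · rw [hx, Complex.conj_conj]
  · rw [hx, Complex.conj_conj]

lemma IsConj.unique {v v' v'' : V Ω ΓD ΓR} (h' : IsConj v v') (h'' : IsConj v v'') :
    v' = v'' := by
  refine Subtype.ext (Prod.ext (Lp.ext ?_) (Prod.ext (Lp.ext ?_) (Lp.ext ?_)))
  · filter_upwards [h'.1, h''.1] with x hx' hx''
    exact hx'.trans hx''.symm
  · filter_upwards [h'.2.1, h''.2.1] with x hx' hx''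
    exact PiLp.ext fun i => (hx' i).trans (hx'' i).symm
  · filter_upwards [h'.2.2, h''.2.2] with x hx' hx''
    exact hx'.trans hx''.symm

lemma conjV_conjV (v : V Ω ΓD ΓR) : conjV Ω ΓD ΓR (conjV Ω ΓD ΓR v) = v :=
  (isConj_conjV _).unique (isConj_conjV v).symm

lemma IsConj.form_eq {u u' v v' : V Ω ΓD ΓR} (hu : IsConj u u') (hv : IsConj v v') (κ : ℝ) :
    form κ u' v' = form κ v u := by
  have grad_eq : ∫ x in Ω, ∑ i, grad u' x i * conj (grad v' x i) =
      ∫ x in Ω, ∑ i, grad v x i * conj (grad u x i) := by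
    refine integral_congr_ae ?_
    filter_upwards [hu.2.1, hv.2.1] with x hux hvx
    simp [hux, hvx, mul_comm]
  have fn_eq : ∫ x in Ω, fn u' x * conj (fn v' x) = ∫ x in Ω, fn v x * conj (fn u x) := by
    refine integral_congr_ae ?_
    filter_upwards [hu.1, hv.1] with x hux hvx
    simp [hux, hvx, mul_comm]
  have tr_eq : ∫ x in ΓR, tr u' x * conj (tr v' x) ∂(surface d) =
      ∫ x in ΓR, tr v x * conj (tr u x) ∂(surface d) := by
    refine integral_congr_ae (ae_restrict_of_ae_restrict_of_subset
      (subset_union_right (s := ΓD)) ?_)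
    filter_upwards [hu.2.2, hv.2.2] with x hux hvx
    simp [hux, hvx, mul_comm]
  rw [form, form, grad_eq, fn_eq, tr_eq]

lemma IsConj.normV_eq {v v' : V Ω ΓD ΓR} (h : IsConj v v') (κ : ℝ) :
    normV κ v' = normV κ v := by
  have norm_fn_eq : ‖fn v'‖ = ‖fn v‖ := by
    rw [Lp.norm_def, Lp.norm_def]
    refine congrArg ENNReal.toReal (eLpNorm_congr_norm_ae ?_)
    filter_upwards [h.1] with x hx
    rw [hx, RCLike.norm_conj]
  have norm_grad_eq : ‖grad v'‖ = ‖grad v‖ := by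
    rw [Lp.norm_def, Lp.norm_def]
    refine congrArg ENNReal.toReal (eLpNorm_congr_norm_ae ?_)
    filter_upwards [h.2.1] with x hx
    simp [EuclideanSpace.norm_eq, hx]
  rw [normV, normV, norm_fn_eq, norm_grad_eq]

namespace Mesh

variable (T : Mesh Ω)

lemma nodal_conjV (z : Rd d) (v : V Ω ΓD ΓR) :
    T.nodal z (conjV Ω ΓD ΓR v) = conj (T.nodal z v) := by
  have integral_fn_eq : ∫ x in Ω, fn (conjV Ω ΓD ΓR v) x * (T.hat z x : ℂ) =
      conj (∫ x in Ω, fn v x * (T.hat z x : ℂ)) := by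
    rw [← integral_conj]
    refine integral_congr_ae ?_
    filter_upwards [(isConj_conjV v).1] with x hx
    rw [hx, map_mul, Complex.conj_ofReal]
  have conj_integral_hat : conj (∫ x in Ω, (T.hat z x : ℂ)) = ∫ x in Ω, (T.hat z x : ℂ) := by
    simp only [← integral_conj, Complex.conj_ofReal]
  rw [nodal, nodal, map_div₀, integral_fn_eq, conj_integral_hat]

lemma interp_conjV (v : V Ω ΓD ΓR) (x : Rd d) :
    T.interp (conjV Ω ΓD ΓR v) x = conj (T.interp v x) := by
  simp only [interp, nodal_conjV, map_sum, map_mul, Complex.conj_ofReal]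

lemma conjV_mem_W {v : V Ω ΓD ΓR} (hv : v ∈ T.W ΓD ΓR) : conjV Ω ΓD ΓR v ∈ T.W ΓD ΓR := by
  have interp_eq_zero : ∀ᵐ x ∂volume.restrict Ω, T.interp v x = 0 := hv
  refine interp_eq_zero.mono fun x hx => ?_
  rw [interp_conjV, hx, map_zero]

end Mesh

end Conjugation

section AdjointCorrection

variable {N : Submodule ℂ (V Ω ΓD ΓR)}

/-- The operator `v ↦ conj (C (conj v))`. For the correction operator `C` of a conjugation-stable
subspace `N` it is the adjoint correction operator. -/
def conjugate (hN : ∀ w ∈ N, conjV Ω ΓD ΓR w ∈ N) (C : V Ω ΓD ΓR →ₗ[ℂ] N) :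
    V Ω ΓD ΓR →ₗ[ℂ] N :=
  ((conjV Ω ΓD ΓR).restrict hN).comp (C.comp (conjV Ω ΓD ΓR))

lemma isConj_conjugate (hN : ∀ w ∈ N, conjV Ω ΓD ΓR w ∈ N) (C : V Ω ΓD ΓR →ₗ[ℂ] N)
    (v : V Ω ΓD ΓR) :
    IsConj (C (conjV Ω ΓD ΓR v) : V Ω ΓD ΓR) (conjugate hN C v : V Ω ΓD ΓR) :=
  isConj_conjV _

lemma form_conjV_conjV (κ : ℝ) (u v : V Ω ΓD ΓR) :
    form κ (conjV Ω ΓD ΓR u) (conjV Ω ΓD ΓR v) = form κ v u :=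
  (isConj_conjV u).form_eq (isConj_conjV v) κ

lemma forall_form_eq_iff_eq_conjugate {κ : ℝ} (hN : ∀ w ∈ N, conjV Ω ΓD ΓR w ∈ N)
    {C : V Ω ΓD ΓR →ₗ[ℂ] N}
    (hC : ∀ (v : V Ω ΓD ΓR) (c : N), (∀ w ∈ N, form κ c w = form κ v w) ↔ c = C v)
    (v : V Ω ΓD ΓR) (c : N) :
    (∀ w ∈ N, form κ w c = form κ w v) ↔ c = conjugate hN C v := by
  have conj_problem : (∀ w ∈ N, form κ w c = form κ w v) ↔
      ∀ w ∈ N, form κ (conjV Ω ΓD ΓR c) w = form κ (conjV Ω ΓD ΓR v) w := by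
    refine ⟨fun h w hw => ?_, fun h w hw => ?_⟩
    · rw [← conjV_conjV w, form_conjV_conjV, form_conjV_conjV]
      exact h _ (hN w hw)
    · simpa only [form_conjV_conjV] using h _ (hN w hw)
  have conjV_involutive : Function.Involutive (conjV Ω ΓD ΓR) := conjV_conjV
  rw [conj_problem, hC (conjV Ω ΓD ΓR v) ⟨conjV Ω ΓD ΓR c, hN c c.2⟩, ← Subtype.coe_inj,
    ← Subtype.coe_inj (a := c)]
  exact conjV_involutive.eq_iff

end AdjointCorrection

end Helmholtz

end

theorem mainTheorem8_general {d : ℕ} (hd : 1 ≤ d) {Ω ΓD ΓR : Set (Helmholtz.Rd d)}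
    (hD : MeasurableSet ΓD) {κ : ℝ} (hκ : 0 < κ) (T : Helmholtz.Mesh Ω)
    {CI : ℝ} (hCI : 0 < CI) (hI : T.IsInterpolationConstant ΓD ΓR CI)
    {Ca : ℝ} (hCa : Helmholtz.IsContinuityConstant Ω ΓD ΓR κ Ca)
    (hres : T.size * κ ≤ 1 / (√(2 * (T.overlap : ℝ)) * CI)) :
    (∀ w ∈ T.W ΓD ΓR, ‖Helmholtz.grad w‖ ≤ Helmholtz.normV κ w ∧
      Helmholtz.normV κ w ≤ √(3 / 2) * ‖Helmholtz.grad w‖) ∧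
    (∀ w ∈ T.W ΓD ΓR, 1 / 3 * Helmholtz.normV κ w ^ 2 ≤ (Helmholtz.form κ w w).re) ∧
    ∃ C Cs : Helmholtz.V Ω ΓD ΓR →ₗ[ℂ] T.W ΓD ΓR,
      (∀ (v : Helmholtz.V Ω ΓD ΓR) (c : T.W ΓD ΓR),
        (∀ w ∈ T.W ΓD ΓR, Helmholtz.form κ c.1 w = Helmholtz.form κ v w) ↔ c = C v) ∧
      (∀ (v : Helmholtz.V Ω ΓD ΓR) (c : T.W ΓD ΓR),
        (∀ w ∈ T.W ΓD ΓR, Helmholtz.form κ w c.1 = Helmholtz.form κ w v) ↔ c = Cs v) ∧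
      (∀ v : Helmholtz.V Ω ΓD ΓR,
        Helmholtz.normV κ (C v).1 ≤ 3 * Ca * Helmholtz.normV κ v ∧
        Helmholtz.normV κ (Cs v).1 ≤ 3 * Ca * Helmholtz.normV κ v) ∧
      (∀ v : Helmholtz.V Ω ΓD ΓR, ∃ v' : Helmholtz.V Ω ΓD ΓR, Helmholtz.IsConj v v' ∧
        Helmholtz.IsConj (C v').1 (Cs v).1 ∧
        Helmholtz.normV κ (Cs v).1 = Helmholtz.normV κ (C v').1) := by
  have poincare (w) (hw : w ∈ T.W ΓD ΓR) :
      κ ^ 2 * ‖Helmholtz.fn w‖ ^ 2 ≤ 1 / 2 * ‖Helmholtz.grad w‖ ^ 2 :=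
    hI.sq_mul_norm_fn_sq_le hd hκ.le hCI hres hw
  have coercive (w) (hw : w ∈ T.W ΓD ΓR) :
      1 / 3 * Helmholtz.normV κ w ^ 2 ≤ (Helmholtz.form κ w w).re := by
    linarith [Helmholtz.mul_normV_sq_le_mul_form_self_re hD (poincare w hw)]
  have coercive_norm (w) (hw : w ∈ T.W ΓD ΓR) :
      1 / 3 * Helmholtz.normV κ w ^ 2 ≤ ‖Helmholtz.form κ w w‖ :=
    (coercive w hw).trans (Complex.re_le_norm _)
  obtain ⟨C, hC⟩ := Helmholtz.exists_correction hD hκ hCa T.isClosed_W (by norm_num) coercive_norm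
  have normV_C_le (v) : Helmholtz.normV κ (C v).1 ≤ 3 * Ca * Helmholtz.normV κ v := by
    linarith [hCa.mul_normV_le (coercive_norm _ (C v).2) ((hC v _).2 rfl _ (C v).2)]
  have stable (w) : w ∈ T.W ΓD ΓR → Helmholtz.conjV Ω ΓD ΓR w ∈ T.W ΓD ΓR := T.conjV_mem_W
  have isConj_Cs := Helmholtz.isConj_conjugate stable C
  refine ⟨fun w hw => ⟨Helmholtz.norm_grad_le_normV κ w, ?_⟩, coercive, C,
    Helmholtz.conjugate stable C, hC, Helmholtz.forall_form_eq_iff_eq_conjugate stable hC,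
    fun v => ⟨normV_C_le v, ?_⟩,
    fun v => ⟨_, Helmholtz.isConj_conjV v, isConj_Cs v, (isConj_Cs v).normV_eq κ⟩⟩
  · convert Helmholtz.normV_le_sqrt_mul_norm_grad (poincare w hw) using 3
    norm_num
  · rw [(isConj_Cs v).normV_eq, ← (Helmholtz.isConj_conjV v).normV_eq]
    exact normV_C_le _

theorem mainTheorem8 (d : ℕ) (hd : 1 ≤ d ∧ d ≤ 3)
    (Ω ΓD ΓN ΓR : Set (Helmholtz.Rd d))
    (hΩ : Helmholtz.IsLipschitzDomain Ω)
    (hΓ : Helmholtz.IsBoundaryPartition Ω ΓD ΓN ΓR)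
    (κ : ℝ) (hκ : 0 < κ)
    (T : Helmholtz.Mesh Ω)
    (CI : ℝ) (hCI : 0 < CI) (hI : T.IsInterpolationConstant ΓD ΓR CI)
    (Ca : ℝ) (hCa : Helmholtz.IsContinuityConstant Ω ΓD ΓR κ Ca)
    (hres : T.size * κ ≤ 1 / (√(2 * (T.overlap : ℝ)) * CI)) :
    (∀ w ∈ T.W ΓD ΓR, ‖Helmholtz.grad w‖ ≤ Helmholtz.normV κ w ∧
      Helmholtz.normV κ w ≤ √(3 / 2) * ‖Helmholtz.grad w‖) ∧
    (∀ w ∈ T.W ΓD ΓR, 1 / 3 * Helmholtz.normV κ w ^ 2 ≤ (Helmholtz.form κ w w).re) ∧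
    ∃ C Cs : Helmholtz.V Ω ΓD ΓR →ₗ[ℂ] T.W ΓD ΓR,
      (∀ (v : Helmholtz.V Ω ΓD ΓR) (c : T.W ΓD ΓR),
        (∀ w ∈ T.W ΓD ΓR, Helmholtz.form κ c.1 w = Helmholtz.form κ v w) ↔ c = C v) ∧
      (∀ (v : Helmholtz.V Ω ΓD ΓR) (c : T.W ΓD ΓR),
        (∀ w ∈ T.W ΓD ΓR, Helmholtz.form κ w c.1 = Helmholtz.form κ w v) ↔ c = Cs v) ∧
      (∀ v : Helmholtz.V Ω ΓD ΓR,
        Helmholtz.normV κ (C v).1 ≤ 3 * Ca * Helmholtz.normV κ v ∧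
        Helmholtz.normV κ (Cs v).1 ≤ 3 * Ca * Helmholtz.normV κ v) ∧
      (∀ v : Helmholtz.V Ω ΓD ΓR, ∃ v' : Helmholtz.V Ω ΓD ΓR, Helmholtz.IsConj v v' ∧
        Helmholtz.IsConj (C v').1 (Cs v).1 ∧
        Helmholtz.normV κ (Cs v).1 = Helmholtz.normV κ (C v').1) :=
  mainTheorem8_general hd.1 hΓ.measurableSet_dirichlet hκ T hCI hI hCa hres
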